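/- **Setting.** Let $x,x'$ be databases that differ in exactly one entry, $\mathcal E$ a measurable set of outputs, $\varepsilon\ge 0$, $\alpha\in(0,1)$ and $\beta\in[0,1/2)$. For a sample size $n$ let $T=T(n)\in\mathbb N$ be the time horizon, and assume that there is $\rho\ge 0$ such that $T(n)/n^\rho$ converges to a positive real number as $n\to\infty$ (Assumption 1). Fix $K\ge 0$, proportions $0<\theta_1<\dots<\theta_K<1$ and randomized algorithms $A^{(0)},\dots,A^{(K)}$, none of which depends on $n$. Put $t_0=1$ and $t_k=\lfloor T\theta_k\rfloor$ for $1\le k\le K$, and suppose that $1<t_1<\dots<t_K<T$ for all large $n$. The algorithm in use at time $t\in\{1,\dots,T\}$ is $A_t=A^{(k)}$ for $t_k\le t<t_{k+1}$ (and $A_t=A^{(K)}$ for $t\ge t_K$). Let $$p_t=\mathbb P(A_t(x)\in\mathcal E)-e^{\varepsilon}\,\mathbb P(A_t(x')\in\mathcal E);$$ no privacy violation over time (NPVT) means $\max_{1\le t\le T}p_t\le 0$. At each time $t\le T$ one observes $X_{1,t},\dots,X_{n,t}\sim A_t(x)$ and $Y_{1,t},\dots,Y_{n,t}\sim A_t(x')$,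 all independent. With $n_t^X=|\{i:X_{i,t}\in\mathcal E\}|$ and $n_t^Y=|\{i:Y_{i,t}\in\mathcal E\}|$ put $$\hat p_t=\frac{n_t^X-e^\varepsilon n_t^Y}{n},\qquad \hat\sigma_t^2=\frac{n_t^X}{n^2}\Big(1-\frac{n_t^X}{n}\Big)+e^{2\varepsilon}\frac{n_t^Y}{n^2}\Big(1-\frac{n_t^Y}{n}\Big),$$ $$\widehat D(\tau)=\max_{0\le \ell<\tau}\frac{1}{(\ell+1)^\beta\,T^{1/2-\beta}}\sum_{t=\tau-\ell}^{\tau}\frac{\hat p_t}{\hat\sigma_t},$$ where the ratio $\hat p_t/\hat\sigma_t$ is read as $0$ if $\hat\sigma_t=0$. Let $q(\alpha)$ be the upper $\alpha$-quantile of $D=\sup_{0\le u<v\le1}\frac{B(v)-B(u)}{(v-u)^\beta}$, where $B$ is a standard Brownian motion. **Theorem 2.** Suppose that the NPVT condition is violated, let $k^*\in\{0,\dots,K\}$ be the first period with $p_{t_{k^*}}>0$, and suppose that it is not the case that both $\mathbb P(A^{(k^*)}(x)\in\mathcal E)=1$ and $\mathbb P(A^{(k^*)}(x')\in\mathcal E)=0$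 (equivalently, $\hat p_t$ has positive variance in that period). Let $\tau^*$ be the first time $\tau\in\{t_{k^*},\dots,T\}$ with $\widehat D(\tau)>q(\alpha)$, and $\tau^*=\infty$ if there is none. Then, as $n\to\infty$, $$\tau^*-t_{k^*}=\mathcal O_P\bigg(\frac{T^{(1/2-\beta)/(1-\beta)}}{n^{1/(2(1-\beta))}}\bigg),$$ that is, with $a_n$ denoting the expression in brackets, for every $\delta>0$ there is $M>0$ such that $\mathbb P(\tau^*-t_{k^*}>M a_n)\le\delta$ for all large $n$. -/

import Mathlib

open MeasureTheory ProbabilityTheory Filter Topology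
open scoped NNReal ENNReal

noncomputable section

namespace DPMonitor

/-! ### Stochastic boundedness -/

/-- `Z n = O_P(a n)`: the sequence `Z n / a n` is stochastically bounded, where `Z n` lives on its
own probability space `(Ω n, P n)` and may take the value `∞`. For every `δ > 0` there is a constant
`M` such that `Z n ≤ M * a n` with probability at least `1 - δ`, for all large `n`. -/
def IsBigOP {Ω : ℕ → Type*} [∀ n, MeasurableSpace (Ω n)] (P : ∀ n, Measure (Ω n))
    (Z : ∀ n, Ω n → ℝ≥0∞) (a : ℕ → ℝ) : Prop :=
  ∀ δ : ℝ, 0 < δ → ∃ M : ℝ, 0 < M ∧ ∀ᶠ n in atTop,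
    P n {ω | ENNReal.ofReal (M * a n) < Z n ω} ≤ ENNReal.ofReal δ

/-! ### The evolving algorithm -/

/-- Two databases with `d` rows are neighbours if they differ in exactly one entry. -/
def Neighbors {d : ℕ} {R : Type*} (x x' : Fin d → R) : Prop :=
  ∃! i, x i ≠ x' i

/-- The time `⌊T θ⌋` of the modification at proportion `θ` of the time horizon `T`. -/
def changeTime {K : ℕ} (θ : Fin K → ℝ) (T : ℕ) (k : Fin K) : ℕ :=
  ⌊(T : ℝ) * θ k⌋₊

/-- The modification times satisfy `1 < t_1 < ... < t_K < T`. -/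
structure ProperChangeTimes {K : ℕ} (θ : Fin K → ℝ) (T : ℕ) : Prop where
  one_lt : ∀ k, 1 < changeTime θ T k
  strictMono : StrictMono (changeTime θ T)
  lt_horizon : ∀ k, changeTime θ T k < T

/-- The `K` modifications split the times `1, ..., T` into `K + 1` periods, numbered `0, ..., K`.
Period `k ≥ 1` begins with the `k`-th modification, period `0` begins at time `1`. -/
def periodStart {K : ℕ} (θ : Fin K → ℝ) (T : ℕ) : Fin (K + 1) → ℕ :=
  Fin.cons 1 (changeTime θ T)

/-- The period to which time `t` belongs: the number of modifications made up to time `t`. -/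
def period {K : ℕ} (θ : Fin K → ℝ) (T t : ℕ) : Fin (K + 1) :=
  ⟨(Finset.univ.filter fun k => changeTime θ T k ≤ t).card,
    Nat.lt_succ_of_le ((Finset.card_filter_le _ _).trans (by simp))⟩

section Algorithm

variable {DB 𝓨 : Type*} [MeasurableSpace 𝓨]

/-- `ℙ(A(x) ∈ E) - e^ε ℙ(A(x') ∈ E)`, for an algorithm that maps a database to the distribution of
its output. -/
def privacyGap (ε : ℝ) (x x' : DB) (E : Set 𝓨) (A : DB → ProbabilityMeasure 𝓨) : ℝ :=
  (A x : Measure 𝓨).real E - Real.exp ε * (A x' : Measure 𝓨).real E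

/-- `n` times the variance of the estimator `pHat` below:
`q_X (1 - q_X) + e^{2ε} q_Y (1 - q_Y)` with `q_X = ℙ(A(x) ∈ E)` and `q_Y = ℙ(A(x') ∈ E)`. -/
def gapVariance (ε : ℝ) (x x' : DB) (E : Set 𝓨) (A : DB → ProbabilityMeasure 𝓨) : ℝ :=
  (A x : Measure 𝓨).real E * (1 - (A x : Measure 𝓨).real E) +
    Real.exp (2 * ε) * ((A x' : Measure 𝓨).real E * (1 - (A x' : Measure 𝓨).real E))

/-- No privacy violation over time: `p_t ≤ 0` for all `1 ≤ t ≤ T`, where the algorithm in use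
during period `k` is `A k`. -/
def NPVT {K : ℕ} (ε : ℝ) (x x' : DB) (E : Set 𝓨) (A : Fin (K + 1) → DB → ProbabilityMeasure 𝓨)
    (θ : Fin K → ℝ) (T : ℕ) : Prop :=
  ∀ t ∈ Finset.Icc 1 T, privacyGap ε x x' E (A (period θ T t)) ≤ 0

/-- The data: at each time `1 ≤ t ≤ T` one has `n` runs `X t i` of the current algorithm on the
database `x` and `n` runs `Y t i` on `x'`; all these runs are independent. -/
structure IsAuditSample {K n : ℕ} {Ω : Type*} [MeasurableSpace Ω] (P : Measure Ω) (x x' : DB)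
    (A : Fin (K + 1) → DB → ProbabilityMeasure 𝓨) (θ : Fin K → ℝ) (T : ℕ)
    (X Y : ℕ → Fin n → Ω → 𝓨) : Prop where
  measurable_X : ∀ t ∈ Finset.Icc 1 T, ∀ i, Measurable (X t i)
  measurable_Y : ∀ t ∈ Finset.Icc 1 T, ∀ i, Measurable (Y t i)
  law_X : ∀ t ∈ Finset.Icc 1 T, ∀ i, P.map (X t i) = (A (period θ T t) x : Measure 𝓨)
  law_Y : ∀ t ∈ Finset.Icc 1 T, ∀ i, P.map (Y t i) = (A (period θ T t) x' : Measure 𝓨)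
  indep : iIndepFun
    (Sum.elim (fun j : Finset.Icc 1 T × Fin n => X j.1 j.2)
      (fun j : Finset.Icc 1 T × Fin n => Y j.1 j.2)) P

end Algorithm

/-! ### The monitoring statistic -/

section Statistic

variable {𝓨 : Type*} {n : ℕ}

open Classical in
/-- The number of outputs in the list `z` that lie in the event `E`. -/
def count (E : Set 𝓨) (z : Fin n → 𝓨) : ℕ :=
  (Finset.univ.filter fun i => z i ∈ E).card

/-- The estimator of the privacy gap from the outputs `z` (for `x`) and `z'` (for `x'`). -/
def pHat (ε : ℝ) (E : Set 𝓨) (z z' : Fin n → 𝓨) : ℝ :=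
  ((count E z : ℝ) - Real.exp ε * (count E z' : ℝ)) / (n : ℝ)

/-- The estimated standard deviation of `pHat`. -/
def sigmaHat (ε : ℝ) (E : Set 𝓨) (z z' : Fin n → 𝓨) : ℝ :=
  Real.sqrt
    ((count E z : ℝ) / (n : ℝ) ^ 2 * (1 - (count E z : ℝ) / (n : ℝ)) +
      Real.exp (2 * ε) * ((count E z' : ℝ) / (n : ℝ) ^ 2 * (1 - (count E z' : ℝ) / (n : ℝ))))

/-- The standardized estimator. The ratio is read as `0` when `sigmaHat` vanishes. -/
def zScore (ε : ℝ) (E : Set 𝓨) (z z' : Fin n → 𝓨) : ℝ :=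
  pHat ε E z z' / sigmaHat ε E z z'

/-- The weighted aggregator at time `τ ≥ 1` of a sequence `r 1, ..., r τ`:
the maximum over `0 ≤ ℓ < τ` of `(∑_{t = τ - ℓ}^τ r t) / ((ℓ + 1)^β T^(1/2 - β))`. -/
def detector (β : ℝ) (T : ℕ) (r : ℕ → ℝ) (τ : ℕ) : ℝ :=
  ⨆ ℓ : Fin τ, (1 / (((ℓ : ℕ) + 1 : ℝ) ^ β * (T : ℝ) ^ (1 / 2 - β))) *
    ∑ t ∈ Finset.Icc (τ - (ℓ : ℕ)) τ, r t

/-- The first time `τ ∈ {s, ..., T}` at which the detector `D` exceeds the threshold `q`;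
it is `∞` if there is no such time. -/
def detectionTime (q : ℝ) (D : ℕ → ℝ) (s T : ℕ) : ℕ∞ :=
  ⨅ τ ∈ {τ : ℕ | s ≤ τ ∧ τ ≤ T ∧ q < D τ}, (τ : ℕ∞)

/-- The detection delay `detectionTime - s`, in `{0, 1, 2, ..., ∞}`. -/
def detectionDelay (q : ℝ) (D : ℕ → ℝ) (s T : ℕ) : ℝ≥0∞ :=
  ((detectionTime q D s T - (s : ℕ∞) : ℕ∞) : ℝ≥0∞)

end Statistic

/-! ### The threshold -/

section Threshold

variable {Ω : Type*} [MeasurableSpace Ω]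

/-- The supremum of the weighted increments of a process `B` over `0 ≤ u < v ≤ 1`. For a Brownian
motion and `0 ≤ β < 1 / 2` it is finite almost surely. -/
def weightedSup (β : ℝ) (B : ℝ≥0 → Ω → ℝ) (ω : Ω) : ℝ :=
  sSup {y : ℝ | ∃ u v : ℝ≥0, u < v ∧ v ≤ 1 ∧ y = (B v ω - B u ω) / ((v : ℝ) - (u : ℝ)) ^ β}

/-- The upper `α`-quantile of a real random variable `D`, i.e. its `(1 - α)`-quantile. -/
def upperQuantile (P : Measure Ω) (D : Ω → ℝ) (α : ℝ) : ℝ :=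
  sInf {y : ℝ | 1 - α ≤ P.real {ω | D ω ≤ y}}

end Threshold

end DPMonitor

end

open DPMonitor

namespace DPMonitor

/-! In the violating period the standardized estimator has order `√n`. If all empirical frequencies
lie within a fixed `η` of their probabilities, it is at least `√n κ` with a constant `κ > 0`
(`le_zScore`). A window of `L` such times, starting with the period, pushes the detector to at least
`L^(1-β) √n κ / T^(1/2-β)`, which exceeds any fixed real `q` once `L` is a large multiple of the
claimed rate (`le_detector`, `lt_window`).

By Hoeffding and a union bound over at most `T` times, some frequency in the window is off with
probability at most `4 T exp(-2nη²)`, which vanishes because `T` is polynomial in `n`. The window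
fits into the period because the rate is negligible against `T` (`eventually_delayRate_le`). Of the
threshold, only that it is a fixed real number matters. -/

lemma count_eq_sum_indicator {𝓨 : Type*} {n : ℕ} (E : Set 𝓨) (z : Fin n → 𝓨) :
    (count E z : ℝ) = ∑ i, E.indicator (fun _ => (1 : ℝ)) (z i) := by
  classical
  simp [count, Set.indicator_apply, Finset.sum_boole]

/-! ### Concentration of empirical frequencies. -/

section Deviation

variable {Ω 𝓨 : Type*} [MeasurableSpace Ω] [MeasurableSpace 𝓨]

/-- Hoeffding's inequality for the sum of centred indicators, up to a sign `s = ± 1`. -/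
lemma measureReal_le_sum_indicator_le {P : Measure Ω} [IsProbabilityMeasure P] {n : ℕ} (hn : 0 < n)
    {Z : Fin n → Ω → 𝓨} (hZ : ∀ i, Measurable (Z i)) (hind : iIndepFun Z P) {ν : Measure 𝓨}
    (hlaw : ∀ i, P.map (Z i) = ν) {E : Set 𝓨} (hE : MeasurableSet E) {s : ℝ} (hs : s ^ 2 = 1)
    {η : ℝ} (hη : 0 ≤ η) :
    P.real {ω | η ≤ s * ((count E fun i => Z i ω) / n - ν.real E)}
      ≤ Real.exp (-2 * n * η ^ 2) := by
  have hn' : (0 : ℝ) < n := by exact_mod_cast hn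
  have hmeas : Measurable (E.indicator fun _ : 𝓨 => (1 : ℝ)) := measurable_const.indicator hE
  have hmean : ∀ i, ∫ ω, E.indicator (fun _ => (1 : ℝ)) (Z i ω) ∂P = ν.real E := by
    intro i
    rw [← integral_map (hZ i).aemeasurable hmeas.aestronglyMeasurable, hlaw i,
      integral_indicator_const _ hE]
    simp
  have hsub : ∀ i, HasSubgaussianMGF
      (fun ω => E.indicator (fun _ => (1 : ℝ)) (Z i ω) - ν.real E) (1 / 4) P := by
    intro i
    have h := hasSubgaussianMGF_of_mem_Icc (μ := P) (a := 0) (b := 1)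
      (X := fun ω => E.indicator (fun _ => (1 : ℝ)) (Z i ω))
      (hmeas.comp (hZ i)).aemeasurable
      (Eventually.of_forall fun ω => ⟨Set.indicator_nonneg (by simp) _,
        Set.indicator_le_self' (by simp) _⟩)
    rw [hmean i] at h
    convert h using 1
    norm_num
  have hsub' : ∀ i, HasSubgaussianMGF
      (fun ω => s * (E.indicator (fun _ => (1 : ℝ)) (Z i ω) - ν.real E)) (1 / 4) P := by
    intro i
    convert (hsub i).const_mul s using 1
    ext
    change (1 / 4 : ℝ) = s ^ 2 * (1 / 4 : ℝ≥0)
    rw [hs]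
    norm_num
  have hind' : iIndepFun
      (fun i ω => s * (E.indicator (fun _ => (1 : ℝ)) (Z i ω) - ν.real E)) P :=
    hind.comp (fun _ y => s * (E.indicator (fun _ => (1 : ℝ)) y - ν.real E))
      fun _ => (hmeas.sub_const _).const_mul _
  have h := HasSubgaussianMGF.measure_sum_ge_le_of_iIndepFun hind' (s := Finset.univ)
    (fun i _ => hsub' i) (ε := n * η) (by positivity)
  refine le_trans (measureReal_mono ?_) (h.trans_eq ?_)
  · intro ω hω
    simp only [Set.mem_ofPred_eq] at hω ⊢
    rw [← Finset.mul_sum, Finset.sum_sub_distrib, ← count_eq_sum_indicator]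
    simp only [Finset.sum_const, Finset.card_univ, Fintype.card_fin, nsmul_eq_mul]
    calc n * η ≤ n * (s * ((count E fun i => Z i ω) / n - ν.real E)) := by gcongr
      _ = _ := by field_simp
  -- The `n` variance proxies `1/4` add up to `n/4`, and `-(nη)² / (2 · n/4) = -2nη²`.
  · congr 1
    simp
    field_simp
    norm_num

lemma measureReal_count_deviation_le {P : Measure Ω} [IsProbabilityMeasure P] {n : ℕ} (hn : 0 < n)
    {Z : Fin n → Ω → 𝓨} (hZ : ∀ i, Measurable (Z i)) (hind : iIndepFun Z P) {ν : Measure 𝓨}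
    (hlaw : ∀ i, P.map (Z i) = ν) {E : Set 𝓨} (hE : MeasurableSet E) {η : ℝ} (hη : 0 ≤ η) :
    P.real {ω | η ≤ |(count E fun i => Z i ω) / (n : ℝ) - ν.real E|}
      ≤ 2 * Real.exp (-2 * n * η ^ 2) := by
  have h₁ := measureReal_le_sum_indicator_le hn hZ hind hlaw hE (s := 1) (by norm_num) hη
  have h₂ := measureReal_le_sum_indicator_le hn hZ hind hlaw hE (s := -1) (by norm_num) hη
  refine (measureReal_mono (fun ω hω => ?_)).trans
    ((measureReal_union_le _ _).trans ((add_le_add h₁ h₂).trans_eq (two_mul _).symm))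
  rw [Set.mem_ofPred_eq] at hω
  rcases le_abs.1 hω with h | h
  · left; simpa using h
  · right; simpa using h

end Deviation

/-! ### Lower bound for the standardized estimator. -/

section ZScore

variable {𝓨 : Type*}

/-- If the empirical frequencies are `η`-close to `a` and `b`, and `η` is small, then the
standardized estimator is at least of order `√n`. -/
lemma le_zScore {n : ℕ} (hn : 0 < n) {ε : ℝ} {E : Set 𝓨} {z z' : Fin n → 𝓨} {a b η : ℝ}
    (hz : |count E z / (n : ℝ) - a| < η) (hz' : |count E z' / (n : ℝ) - b| < η)
    (hp : 0 < a - Real.exp ε * b) (hη : η * (1 + Real.exp ε) ≤ (a - Real.exp ε * b) / 2)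
    (hnd : (η ≤ a ∧ η ≤ 1 - a) ∨ (η ≤ b ∧ η ≤ 1 - b)) :
    √n * ((a - Real.exp ε * b) / (2 * √(1 + Real.exp (2 * ε)))) ≤ zScore ε E z z' := by
  have hn' : (0 : ℝ) < n := by exact_mod_cast hn
  have he : 0 < Real.exp ε := Real.exp_pos _
  have he2 : 0 < Real.exp (2 * ε) := Real.exp_pos _
  have hfreq : ∀ w : Fin n → 𝓨, 0 ≤ count E w / (n : ℝ) ∧ count E w / (n : ℝ) ≤ 1 := fun w =>
    ⟨by positivity, (div_le_one hn').2 (by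
      classical
      simpa [count] using Finset.card_filter_le (Finset.univ : Finset (Fin n)) (fun i => w i ∈ E))⟩
  set u := count E z / (n : ℝ) with hu
  set v := count E z' / (n : ℝ) with hv
  obtain ⟨hu0, hu1⟩ := hfreq z
  obtain ⟨hv0, hv1⟩ := hfreq z'
  rw [← hu] at hu0 hu1
  rw [← hv] at hv0 hv1
  rw [abs_lt] at hz hz'
  have hpHat : pHat ε E z z' = u - Real.exp ε * v := by
    rw [pHat, hu, hv]; ring
  have hsigma : sigmaHat ε E z z' =
      √(u * (1 - u) + Real.exp (2 * ε) * (v * (1 - v))) / √n := by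
    rw [sigmaHat, ← Real.sqrt_div' _ hn'.le]
    congr 1
    rw [hu, hv]
    field_simp
  -- The error of `pHat` is below `η (1 + e^ε)`, at most half the gap.
  have hlow : (a - Real.exp ε * b) / 2 ≤ u - Real.exp ε * v := by nlinarith
  have huu : 0 ≤ u * (1 - u) := mul_nonneg hu0 (by linarith)
  have hvv : 0 ≤ v * (1 - v) := mul_nonneg hv0 (by linarith)
  -- One frequency stays strictly between 0 and 1, so the convention for a vanishing `sigmaHat`
  -- never applies.
  have hpos : 0 < u * (1 - u) + Real.exp (2 * ε) * (v * (1 - v)) := by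
    rcases hnd with h | h
    · have : 0 < u * (1 - u) := mul_pos (by linarith) (by linarith)
      positivity
    · have : 0 < v * (1 - v) := mul_pos (by linarith) (by linarith)
      positivity
  have hup : u * (1 - u) + Real.exp (2 * ε) * (v * (1 - v)) ≤ 1 + Real.exp (2 * ε) := by
    have h1 : u * (1 - u) ≤ 1 := by nlinarith
    have h2 : v * (1 - v) ≤ 1 := by nlinarith
    nlinarith
  have hs := Real.sqrt_pos.2 hpos
  have hs' := Real.sqrt_le_sqrt hup
  have hsn : 0 < √(n : ℝ) := Real.sqrt_pos.2 hn'
  calc √n * ((a - Real.exp ε * b) / (2 * √(1 + Real.exp (2 * ε))))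
      = ((a - Real.exp ε * b) / 2) / √(1 + Real.exp (2 * ε)) * √n := by field_simp
    _ ≤ (u - Real.exp ε * v) / √(u * (1 - u) + Real.exp (2 * ε) * (v * (1 - v))) * √n := by
        gcongr
        linarith
    _ = zScore ε E z z' := by
        rw [zScore, hpHat, hsigma]
        field_simp

end ZScore

/-! ### From large scores to early detection. -/

section Detection

/-- The maximum dominates its term for the window from `s` to `s + ℓ`; `1 ≤ s` makes `ℓ` an
admissible index. -/
lemma le_detector {β : ℝ} {T : ℕ} {r : ℕ → ℝ} {s ℓ : ℕ} (hs : 1 ≤ s) {m : ℝ}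
    (hr : ∀ t ∈ Finset.Icc s (s + ℓ), m ≤ r t) :
    1 / (((ℓ : ℝ) + 1) ^ β * (T : ℝ) ^ (1 / 2 - β)) * (((ℓ : ℝ) + 1) * m)
      ≤ detector β T r (s + ℓ) := by
  have h := le_ciSup (f := fun j : Fin (s + ℓ) =>
    (1 / (((j : ℕ) + 1 : ℝ) ^ β * (T : ℝ) ^ (1 / 2 - β))) *
      ∑ t ∈ Finset.Icc (s + ℓ - (j : ℕ)) (s + ℓ), r t)
    (Set.finite_range _).bddAbove ⟨ℓ, by omega⟩
  refine le_trans ?_ h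
  simp only [Nat.add_sub_cancel]
  gcongr
  have hsum := Finset.card_nsmul_le_sum _ _ _ hr
  have hcard : (Finset.Icc s (s + ℓ)).card = ℓ + 1 := by simp; omega
  rw [hcard, nsmul_eq_mul] at hsum
  exact_mod_cast hsum

lemma detectionDelay_le {q : ℝ} {D : ℕ → ℝ} {s T ℓ : ℕ} (hT : s + ℓ ≤ T) (hD : q < D (s + ℓ)) :
    detectionDelay q D s T ≤ ℓ := by
  have h : detectionTime q D s T ≤ ((s + ℓ : ℕ) : ℕ∞) :=
    iInf₂_le (s + ℓ) ⟨Nat.le_add_right _ _, hT, hD⟩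
  have h' : detectionTime q D s T - (s : ℕ∞) ≤ (ℓ : ℕ∞) := by
    rw [tsub_le_iff_left]
    exact_mod_cast h
  have h'' := ENat.toENNReal_le.2 h'
  simpa [detectionDelay] using h''

/-- A window of more than `M T^((1/2-β)/(1-β)) / n^(1/(2(1-β)))` time points on each of which the
standardized estimator is at least `√n κ` makes the detector exceed `q`. -/
lemma lt_window {β κ q M L T n : ℝ} (hβ : β < 1 / 2) (hκ : 0 < κ) (hT : 0 < T) (hn : 0 < n)
    (hM : 0 < M) (hMq : |q| / κ ≤ M ^ (1 - β))
    (hL : M * (T ^ ((1 / 2 - β) / (1 - β)) / n ^ (1 / (2 * (1 - β)))) < L) :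
    q < 1 / (L ^ β * T ^ (1 / 2 - β)) * (L * (√n * κ)) := by
  have hb : 0 < 1 - β := by linarith
  have hLpos : 0 < L := lt_of_le_of_lt (by positivity) hL
  -- The power `1 - β` turns `hL` into `M^(1-β) T^(1/2-β) / √n < L / L^β`.
  have h := Real.rpow_lt_rpow (by positivity) hL hb
  rw [Real.mul_rpow hM.le (by positivity), Real.div_rpow (by positivity) (by positivity),
    ← Real.rpow_mul hT.le, ← Real.rpow_mul hn.le, div_mul_cancel₀ _ hb.ne',
    show 1 / (2 * (1 - β)) * (1 - β) = 1 / 2 by field_simp, ← Real.sqrt_eq_rpow,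
    Real.rpow_sub hLpos, Real.rpow_one] at h
  have hsn : 0 < √n := Real.sqrt_pos.2 hn
  have hTb : 0 < T ^ (1 / 2 - β) := Real.rpow_pos_of_pos hT _
  have hLb : 0 < L ^ β := Real.rpow_pos_of_pos hLpos _
  calc q ≤ |q| := le_abs_self q
    _ ≤ M ^ (1 - β) * κ := (div_le_iff₀ hκ).1 hMq
    _ = M ^ (1 - β) * (T ^ (1 / 2 - β) / √n) * (√n * κ / T ^ (1 / 2 - β)) := by field_simp
    _ < L / L ^ β * (√n * κ / T ^ (1 / 2 - β)) := by gcongr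
    _ = _ := by field_simp

end Detection

/-! ### Combinatorics of the periods. -/

section Periods

variable {K : ℕ} {θ : Fin K → ℝ} {T : ℕ}

/-- The first time after period `k`. -/
noncomputable def periodEnd (θ : Fin K → ℝ) (T : ℕ) (k : Fin (K + 1)) : ℕ :=
  if h : (k : ℕ) < K then changeTime θ T ⟨k, h⟩ else T + 1

lemma one_le_periodStart (hp : ProperChangeTimes θ T) (k : Fin (K + 1)) :
    1 ≤ periodStart θ T k := by
  cases k using Fin.cases with
  | zero => simp [periodStart]
  | succ j => simpa [periodStart] using (hp.one_lt j).le

lemma periodEnd_le (hp : ProperChangeTimes θ T) (k : Fin (K + 1)) : periodEnd θ T k ≤ T + 1 := by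
  unfold periodEnd
  split_ifs with h
  · exact (hp.lt_horizon _).le.trans (Nat.le_succ _)
  · exact le_rfl

lemma periodStart_lt_periodEnd (hp : ProperChangeTimes θ T) (hT : 1 ≤ T) (k : Fin (K + 1)) :
    periodStart θ T k < periodEnd θ T k := by
  unfold periodEnd
  cases k using Fin.cases with
  | zero =>
    simp only [periodStart, Fin.cons_zero]
    split_ifs with h
    · exact hp.one_lt _
    · omega
  | succ j =>
    simp only [periodStart, Fin.cons_succ]
    split_ifs with h
    · exact hp.strictMono (by simp [Fin.lt_def])
    · exact (hp.lt_horizon j).trans (Nat.lt_succ_self _)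

/-- As the change times increase, those up to `t` are exactly the first `k`. -/
lemma period_eq (hp : ProperChangeTimes θ T) {k : Fin (K + 1)} {t : ℕ}
    (hs : periodStart θ T k ≤ t) (he : t < periodEnd θ T k) : period θ T t = k := by
  have key : ∀ j : Fin K, changeTime θ T j ≤ t ↔ (j : ℕ) < k := by
    intro j
    constructor
    · intro hj
      by_contra! hkj
      have hk : (k : ℕ) < K := hkj.trans_lt j.2
      rw [periodEnd, dif_pos hk] at he
      have := hp.strictMono.monotone (show (⟨k, hk⟩ : Fin K) ≤ j from hkj)
      omega
    · intro hj
      cases k using Fin.cases with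
      | zero => simp at hj
      | succ i =>
        simp only [periodStart, Fin.cons_succ] at hs
        exact (hp.strictMono.monotone (Fin.le_def.2 (by simp at hj; omega))).trans hs
  apply Fin.ext
  simp only [period, key]
  rw [Fin.card_filter_val_lt]
  have := k.2
  omega

/-- The length of a period is a positive proportion of the time horizon, up to rounding. -/
lemma exists_pos_mul_sub_two_le_periodEnd_sub (hθ_mono : StrictMono θ)
    (hθ : ∀ k, θ k ∈ Set.Ioo (0 : ℝ) 1) (k : Fin (K + 1)) :
    ∃ d : ℝ, 0 < d ∧ ∀ T : ℕ, T * d - 2 ≤ (periodEnd θ T k : ℝ) - periodStart θ T k := by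
  -- The floor at the end of a period costs at most 1; in period `0`, the start at time 1 costs
  -- another 1.
  have hfl : ∀ (T : ℕ) (j : Fin K), (changeTime θ T j : ℝ) ≤ T * θ j :=
    fun T j => Nat.floor_le (mul_nonneg (Nat.cast_nonneg _) (hθ j).1.le)
  have hfl' : ∀ (T : ℕ) (j : Fin K), T * θ j < (changeTime θ T j : ℝ) + 1 :=
    fun T j => Nat.lt_floor_add_one _
  cases k using Fin.cases with
  | zero =>
    simp only [periodStart, Fin.cons_zero, periodEnd]
    by_cases h : ((0 : Fin (K + 1)) : ℕ) < K
    · refine ⟨θ ⟨_, h⟩, (hθ _).1, fun T => ?_⟩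
      rw [dif_pos h]
      have := hfl' T ⟨_, h⟩
      push_cast
      linarith
    · refine ⟨1, one_pos, fun T => ?_⟩
      rw [dif_neg h]
      push_cast
      linarith
  | succ j =>
    simp only [periodStart, Fin.cons_succ, periodEnd]
    by_cases h : (j.succ : ℕ) < K
    · refine ⟨θ ⟨_, h⟩ - θ j, sub_pos.2 (hθ_mono (by simp [Fin.lt_def])), fun T => ?_⟩
      rw [dif_pos h]
      have := hfl' T ⟨_, h⟩
      have := hfl T j
      linarith
    · refine ⟨1 - θ j, sub_pos.2 (hθ j).2, fun T => ?_⟩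
      rw [dif_neg h]
      have := hfl T j
      push_cast
      linarith

end Periods

/-! ### Growth rates and the choice of `η`. -/

section Asymptotics

lemma tendsto_mul_exp_neg_of_tendsto_div_rpow {T : ℕ → ℕ} {ρ c b : ℝ}
    (hT : Tendsto (fun n : ℕ => (T n : ℝ) / (n : ℝ) ^ ρ) atTop (𝓝 c)) (hb : 0 < b) :
    Tendsto (fun n : ℕ => (T n : ℝ) * Real.exp (-b * n)) atTop (𝓝 0) := by
  have h := (tendsto_rpow_mul_exp_neg_mul_atTop_nhds_zero ρ b hb).comp
    (tendsto_natCast_atTop_atTop (R := ℝ))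
  have h' := hT.mul h
  rw [mul_zero] at h'
  refine h'.congr' ?_
  filter_upwards [eventually_gt_atTop 0] with n hn
  have : (0 : ℝ) < (n : ℝ) ^ ρ := Real.rpow_pos_of_pos (by exact_mod_cast hn) _
  simp only [Function.comp]
  field_simp

/-- `T^((1/2-β)/(1-β)) / n^(1/(2(1-β)))` is negligible compared to `T`, uniformly in `T ≥ 1`. -/
lemma eventually_delayRate_le {β d : ℝ} (hβ : β < 1 / 2) (hd : 0 < d) (M : ℝ) (hM : 0 < M) :
    ∀ᶠ n : ℕ in atTop, ∀ T : ℝ, 1 ≤ T →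
      M * (T ^ ((1 / 2 - β) / (1 - β)) / (n : ℝ) ^ (1 / (2 * (1 - β)))) ≤ T * d := by
  have hb : 0 < 1 - β := by linarith
  have hpow : Tendsto (fun n : ℕ => (n : ℝ) ^ (1 / (2 * (1 - β)))) atTop atTop :=
    (tendsto_rpow_atTop (by positivity)).comp tendsto_natCast_atTop_atTop
  filter_upwards [hpow.eventually_ge_atTop (M / d), eventually_gt_atTop 0] with n hn hn0 T hT
  have hn' : (0 : ℝ) < (n : ℝ) ^ (1 / (2 * (1 - β))) :=
    Real.rpow_pos_of_pos (by exact_mod_cast hn0) _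
  -- The exponent is at most 1 since `1/2 - β ≤ 1 - β`; the smallness comes from the power of `n`
  -- alone, so `T` may stay bounded.
  have hTle : T ^ ((1 / 2 - β) / (1 - β)) ≤ T := by
    conv_rhs => rw [← Real.rpow_one T]
    exact Real.rpow_le_rpow_of_exponent_le hT ((div_le_one hb).2 (by linarith))
  rw [← mul_div_assoc, div_le_iff₀ hn']
  rw [div_le_iff₀ hd] at hn
  have hT0 : 0 ≤ T := by linarith
  calc M * T ^ ((1 / 2 - β) / (1 - β)) ≤ M * T := by gcongr
    _ ≤ ((n : ℝ) ^ (1 / (2 * (1 - β))) * d) * T := by gcongr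
    _ = _ := by ring

/-- The radius within which empirical frequencies have to be close to the true probabilities. -/
lemma exists_deviation_radius {ε a b : ℝ} (ha : a ∈ Set.Icc (0 : ℝ) 1) (hb : b ∈ Set.Icc (0 : ℝ) 1)
    (hp : 0 < a - Real.exp ε * b)
    (hvar : 0 < a * (1 - a) + Real.exp (2 * ε) * (b * (1 - b))) :
    ∃ η : ℝ, 0 < η ∧ η * (1 + Real.exp ε) ≤ (a - Real.exp ε * b) / 2 ∧
      ((η ≤ a ∧ η ≤ 1 - a) ∨ (η ≤ b ∧ η ≤ 1 - b)) := by
  have he : 0 < 1 + Real.exp ε := by positivity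
  have hcase : (0 < a ∧ 0 < 1 - a) ∨ (0 < b ∧ 0 < 1 - b) := by
    by_contra! h
    obtain ⟨h₁, h₂⟩ := h
    have h1 : a * (1 - a) = 0 := by
      rcases ha.1.eq_or_lt with h0 | h0
      · simp [← h0]
      · have : 1 - a = 0 := le_antisymm (h₁ h0) (by linarith [ha.2])
        simp [this]
    have h2 : b * (1 - b) = 0 := by
      rcases hb.1.eq_or_lt with h0 | h0
      · simp [← h0]
      · have : 1 - b = 0 := le_antisymm (h₂ h0) (by linarith [hb.2])
        simp [this]
    simp [h1, h2] at hvar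
  have hr : 0 < (a - Real.exp ε * b) / 2 / (1 + Real.exp ε) := by positivity
  rcases hcase with ⟨h1, h2⟩ | ⟨h1, h2⟩
  · exact ⟨min ((a - Real.exp ε * b) / 2 / (1 + Real.exp ε)) (min a (1 - a)),
      lt_min hr (lt_min h1 h2), (le_div_iff₀ he).1 (min_le_left _ _),
      Or.inl ⟨(min_le_right _ _).trans (min_le_left _ _),
        (min_le_right _ _).trans (min_le_right _ _)⟩⟩
  · exact ⟨min ((a - Real.exp ε * b) / 2 / (1 + Real.exp ε)) (min b (1 - b)),
      lt_min hr (lt_min h1 h2), (le_div_iff₀ he).1 (min_le_left _ _),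
      Or.inr ⟨(min_le_right _ _).trans (min_le_left _ _),
        (min_le_right _ _).trans (min_le_right _ _)⟩⟩

end Asymptotics

/-! ### Concentration for the audit sample. -/

section Sample

variable {DB 𝓨 Ω : Type*} [MeasurableSpace 𝓨] [MeasurableSpace Ω] {K n : ℕ} {P : Measure Ω}
  {x x' : DB} {A : Fin (K + 1) → DB → ProbabilityMeasure 𝓨} {θ : Fin K → ℝ} {T : ℕ}
  {X Y : ℕ → Fin n → Ω → 𝓨}

lemma IsAuditSample.iIndepFun_X (h : IsAuditSample P x x' A θ T X Y) {t : ℕ}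
    (ht : t ∈ Finset.Icc 1 T) : iIndepFun (X t) P :=
  h.indep.precomp (g := fun i : Fin n => Sum.inl ((⟨t, ht⟩ : Finset.Icc 1 T), i)) fun i j hij => by simpa using hij

lemma IsAuditSample.iIndepFun_Y (h : IsAuditSample P x x' A θ T X Y) {t : ℕ}
    (ht : t ∈ Finset.Icc 1 T) : iIndepFun (Y t) P :=
  h.indep.precomp (g := fun i : Fin n => Sum.inr ((⟨t, ht⟩ : Finset.Icc 1 T), i)) fun i j hij => by simpa using hij

lemma IsAuditSample.measureReal_deviation_le [IsProbabilityMeasure P]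
    (h : IsAuditSample P x x' A θ T X Y) (hn : 0 < n) {t : ℕ} (ht : t ∈ Finset.Icc 1 T)
    {k : Fin (K + 1)} (hk : period θ T t = k) {E : Set 𝓨} (hE : MeasurableSet E) {η : ℝ}
    (hη : 0 ≤ η) :
    P.real ({ω | η ≤ |(count E fun i => X t i ω) / (n : ℝ) - (A k x : Measure 𝓨).real E|} ∪
      {ω | η ≤ |(count E fun i => Y t i ω) / (n : ℝ) - (A k x' : Measure 𝓨).real E|})
      ≤ 4 * Real.exp (-2 * n * η ^ 2) := by
  subst hk
  have hX := measureReal_count_deviation_le hn (h.measurable_X t ht) (h.iIndepFun_X ht)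
    (h.law_X t ht) hE hη
  have hY := measureReal_count_deviation_le hn (h.measurable_Y t ht) (h.iIndepFun_Y ht)
    (h.law_Y t ht) hE hη
  exact (measureReal_union_le _ _).trans (by linarith)

end Sample

end DPMonitor
theorem theorem2
    -- databases, output space, event, privacy level
    {d : ℕ} {R 𝓨 : Type*} [MeasurableSpace 𝓨]
    (x x' : Fin d → R) (hx : Neighbors x x')
    (E : Set 𝓨) (hE : MeasurableSet E)
    (ε : ℝ) (hε : 0 ≤ ε)
    -- the algorithms of the `K + 1` periods and the proportions of the modification times
    {K : ℕ} (A : Fin (K + 1) → (Fin d → R) → ProbabilityMeasure 𝓨)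
    (θ : Fin K → ℝ) (hθ_mono : StrictMono θ) (hθ : ∀ k, θ k ∈ Set.Ioo (0 : ℝ) 1)
    -- the time horizon: `T(n) / n^ρ` converges to a positive number
    (T : ℕ → ℕ) (ρ c : ℝ) (hρ : 0 ≤ ρ) (hc : 0 < c)
    (hT : Tendsto (fun n : ℕ => (T n : ℝ) / (n : ℝ) ^ ρ) atTop (𝓝 c))
    (hproper : ∀ᶠ n in atTop, ProperChangeTimes θ (T n))
    -- the outputs, for every sample size `n`
    {Ω : ℕ → Type*} [∀ n, MeasurableSpace (Ω n)]
    (P : ∀ n, Measure (Ω n)) [∀ n, IsProbabilityMeasure (P n)]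
    (X Y : ∀ n, ℕ → Fin n → Ω n → 𝓨)
    (hXY : ∀ n, IsAuditSample (P n) x x' A θ (T n) (X n) (Y n))
    -- weight parameter, nominal level, Brownian motion that defines the threshold
    (β : ℝ) (hβ : β ∈ Set.Ico (0 : ℝ) (1 / 2))
    (α : ℝ) (hα : α ∈ Set.Ioo (0 : ℝ) 1)
    {Ω' : Type*} [MeasurableSpace Ω'] (P' : Measure Ω') [IsProbabilityMeasure P']
    (B : ℝ≥0 → Ω' → ℝ) (hB : IsBrownianReal B P')
    -- the NPVT condition is violated, for the first time in the period `kstar`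
    (hviol : ∀ᶠ n in atTop, ¬ NPVT ε x x' E A θ (T n))
    (kstar : Fin (K + 1))
    (hkstar : IsLeast {k | 0 < privacyGap ε x x' E (A k)} kstar)
    -- the estimator of the privacy gap is not degenerate in that period
    (hvar : 0 < gapVariance ε x x' E (A kstar)) :
    IsBigOP P
      (fun n ω =>
        detectionDelay
          (upperQuantile P' (weightedSup β B) α)
          (detector β (T n)
            (fun t => zScore ε E (fun i => X n t i ω) (fun i => Y n t i ω)))
          (periodStart θ (T n) kstar)
          (T n))
      (fun n => (T n : ℝ) ^ ((1 / 2 - β) / (1 - β)) / (n : ℝ) ^ (1 / (2 * (1 - β)))) := by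
  -- The bound holds for every real threshold `q`: the law of the Brownian functional plays no role.
  set q := upperQuantile P' (weightedSup β B) α
  set a := (A kstar x : Measure 𝓨).real E
  set b := (A kstar x' : Measure 𝓨).real E
  have hgap : 0 < a - Real.exp ε * b := hkstar.1
  have hb : 0 < 1 - β := by linarith [hβ.2]
  obtain ⟨η, hη, hηgap, hnd⟩ := exists_deviation_radius (ε := ε) (a := a) (b := b)
    ⟨measureReal_nonneg, measureReal_le_one⟩ ⟨measureReal_nonneg, measureReal_le_one⟩ hgap hvar
  set κ := (a - Real.exp ε * b) / (2 * √(1 + Real.exp (2 * ε)))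
  have hκ : 0 < κ := by positivity
  obtain ⟨d, hd, hlen⟩ := exists_pos_mul_sub_two_le_periodEnd_sub hθ_mono hθ kstar
  intro δ hδ
  -- `M` does not depend on `δ`, since the failure probability tends to 0; the summand 1 keeps `M`
  -- positive when `q = 0`.
  have hM : 0 < (1 + |q| / κ) ^ (1 / (1 - β)) := by positivity
  refine ⟨(1 + |q| / κ) ^ (1 / (1 - β)), hM, ?_⟩
  set M := (1 + |q| / κ) ^ (1 / (1 - β))
  have hMq : |q| / κ ≤ M ^ (1 - β) := by
    rw [← Real.rpow_mul (by positivity), one_div_mul_cancel hb.ne', Real.rpow_one]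
    linarith
  have hbad := tendsto_mul_exp_neg_of_tendsto_div_rpow hT (b := 2 * η ^ 2) (by positivity)
  filter_upwards [hproper, hviol, eventually_gt_atTop 0,
    eventually_delayRate_le hβ.2 (show 0 < d / 4 by positivity) M hM,
    hbad.eventually_le_const (show 0 < δ / 4 by positivity)] with n hpn hvn hn hrate hexp
  -- For `T n = 0` the NPVT condition would hold vacuously.
  have hT1 : 1 ≤ T n := by
    by_contra! h
    exact hvn fun t ht => by simp at ht; omega
  have hT1' : (1 : ℝ) ≤ T n := by exact_mod_cast hT1
  have hrate := hrate (T n) hT1'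
  set w := M * ((T n : ℝ) ^ ((1 / 2 - β) / (1 - β)) / (n : ℝ) ^ (1 / (2 * (1 - β))))
  have hw : 0 ≤ w := by positivity
  -- The delay `ℓ` is at most `w`, while the window has `ℓ + 1 > w` points.
  set ℓ := ⌊w⌋₊
  have hℓw : (ℓ : ℝ) ≤ w := Nat.floor_le hw
  set s := periodStart θ (T n) kstar
  have hs : 1 ≤ s := one_le_periodStart hpn kstar
  have hse : s < periodEnd θ (T n) kstar := periodStart_lt_periodEnd hpn hT1 kstar
  have heT := periodEnd_le hpn kstar
  have hℓ : s + ℓ < periodEnd θ (T n) kstar := by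
    -- If `T d < 4`, then `w < 1` and the window is a single time; otherwise `T d / 4 < T d - 2`.
    rcases lt_or_ge ((T n : ℝ) * d) 4 with h | h
    · have : ℓ = 0 := Nat.floor_eq_zero.2 (by linarith)
      omega
    · have := hlen (T n)
      have h' : ((s + ℓ : ℕ) : ℝ) < periodEnd θ (T n) kstar := by
        push_cast
        change _ ≤ _ - (s : ℝ) at this
        linarith
      exact_mod_cast h'
  set bad : ℕ → Set (Ω n) := fun t =>
    {ω | η ≤ |(count E fun i => X n t i ω) / (n : ℝ) - a|} ∪
      {ω | η ≤ |(count E fun i => Y n t i ω) / (n : ℝ) - b|} with hbad_def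
  have hbad_le : ∀ t ∈ Finset.Icc s (s + ℓ), (P n).real (bad t) ≤
      4 * Real.exp (-2 * n * η ^ 2) := by
    intro t ht
    rw [Finset.mem_Icc] at ht
    exact (hXY n).measureReal_deviation_le hn (Finset.mem_Icc.2 ⟨by omega, by omega⟩)
      (period_eq hpn ht.1 (by omega)) hE hη.le
  have hsubset : {ω | ENNReal.ofReal w < detectionDelay q
      (detector β (T n) fun t => zScore ε E (fun i => X n t i ω) (fun i => Y n t i ω)) s (T n)} ⊆
      ⋃ t ∈ Finset.Icc s (s + ℓ), bad t := by
    intro ω hω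
    by_contra hgood
    simp only [Set.mem_iUnion, not_exists, hbad_def, Set.mem_union, Set.mem_ofPred_eq, not_or,
      not_le] at hgood
    rw [Set.mem_ofPred_eq] at hω
    refine absurd hω (not_lt.2 ((detectionDelay_le (ℓ := ℓ) (by omega) ?_).trans ?_))
    · refine (lt_window hβ.2 hκ (by linarith) (by exact_mod_cast hn) hM hMq
        (Nat.lt_floor_add_one w)).trans_le (le_detector hs fun t ht => ?_)
      exact le_zScore hn (hgood t ht).1 (hgood t ht).2 hgap hηgap hnd
    · rw [← ENNReal.ofReal_natCast]
      exact ENNReal.ofReal_le_ofReal hℓw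
  have hcard : ((Finset.Icc s (s + ℓ)).card : ℝ) ≤ T n := by
    have : (Finset.Icc s (s + ℓ)).card ≤ T n := by simp; omega
    exact_mod_cast this
  rw [← ofReal_measureReal]
  refine ENNReal.ofReal_le_ofReal ?_
  calc (P n).real _ ≤ (P n).real (⋃ t ∈ Finset.Icc s (s + ℓ), bad t) :=
        measureReal_mono hsubset (measure_ne_top _ _)
    _ ≤ ∑ t ∈ Finset.Icc s (s + ℓ), (P n).real (bad t) := measureReal_biUnion_finset_le _ _
    _ ≤ (Finset.Icc s (s + ℓ)).card • (4 * Real.exp (-2 * n * η ^ 2)) :=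
        Finset.sum_le_card_nsmul _ _ _ hbad_le
    _ ≤ T n * (4 * Real.exp (-2 * n * η ^ 2)) := by
        rw [nsmul_eq_mul]
        gcongr
    _ = 4 * (T n * Real.exp (-(2 * η ^ 2) * n)) := by ring_nf
    _ ≤ δ := by linarith
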